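/- Throughout, $A$ is a unital associative ring (not necessarily commutative), $A$-modules are unital, and $C$ is an $A$-coring: an $(A,A)$-bimodule with $(A,A)$-bimodule maps $\Delta:C\to C\otimes_A C$, $\Delta(c)=\sum c_{1}\otimes c_{2}$, and $\epsilon:C\to A$, coassociative and counital. Let $\gamma:C\otimes_A C\to A$ be a cointegral, that is, an $(A,A)$-bimodule map with $$\sum\gamma(c\otimes c'_{1})c'_{2}=\sum c_{1}\gamma(c_{2}\otimes c'),\qquad \sum\gamma(c_{1}\otimes c_{2})=\epsilon(c)\qquad(c,c'\in C)$$ (so $C$ is coseparable), and let $g\in C$ be grouplike: $\Delta(g)=g\otimes g$, $\epsilon(g)=1$. View $C$ as a non-unital ring, and as an $A$-ring (a ring and an $(A,A)$-bimodule whose product is an $A$-balanced bimodule map), with product $cc'=\sum c_{1}\gamma(c_{2}\otimes c')$. A right $C$-module is a right $A$-module $M$ with an associative right $A$-linear action $M\otimes_A C\to M$, $m\otimes c\mapsto m\cdot c$; morphisms are $A$-linear maps commuting with the actions. For a right $C$-module $M$ and a left $C$-module $N$, $M\otimes_C N$ is the cokernel of $M\otimes_A C\otimes_A N\to M\otimes_A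 N$, $m\otimes c\otimes n\mapsto m\cdot c\otimes n-m\otimes c\cdot n$. $M$ is firm if $M\otimes_C C\to M$, $m\otimes c\mapsto m\cdot c$, is an isomorphism; left firm modules are defined symmetrically. Let ${\bf M}_C$ be the category of firm right $C$-modules and, for a unital ring $B$, ${\bf M}_B$ the category of (unital, equivalently firm) right $B$-modules. For a right $C$-module $M$ put $$M^C_{g,\gamma}=\{m\in M \mid m\cdot c=m\,\gamma(g\otimes c)\text{ for all }c\in C\}.$$ Regard $A$ as a right $C$-module by $a\cdot c=\gamma(ga\otimes c)$. Then: (1) $B=A^C_{g,\gamma}=\{b\in A\mid \gamma(gb\otimes c)=b\gamma(g\otimes c)\text{ for all }c\in C\}$ is a (unital) subring of $A$. (2) $M\mapsto M^C_{g,\gamma}$ (with morphisms restricted, and with the $B$-action inherited from the $A$-action) is a functor ${\bf M}_C\to{\bf M}_B$, and it has the left adjoint $-\otimes_B A:{\bf M}_B\to{\bf M}_C$, where $(n\otimes a)\cdot c=n\otimes a\cdot c$; in particular $N\otimes_B A$ is firm for every right $B$-module $N$. (3) $Q=C^C_{g,\gamma}=\{q\in C\mid qc=q\gamma(g\otimes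 c)\text{ for all }c\in C\}$ is a left ideal of $C$ that is firm as a left $C$-module, and $Q$ is a $(C,B)$-bimodule. (4) For every $M\in{\bf M}_C$ the additive map $\omega_M:M\otimes_C Q\to M^C_{g,\gamma}$, $m\otimes q\mapsto m\cdot q$, is well defined and bijective. (5) The maps $\sigma:Q\otimes_B A\to C$, $q\otimes a\mapsto qa$, and $\tau:A\otimes_C Q\to B$, $a\otimes q\mapsto\gamma(ga\otimes q)$, are well defined, and $(B,C,A,Q,\tau,\sigma)$ is a Morita context in which $\tau$ is surjective, and in fact an isomorphism. Here a Morita context $(R,S,V,W,\tau,\sigma)$ consists of firm non-unital rings $R,S$ (firm as left and right modules over themselves), an $(R,S)$-bimodule $V$ and an $(S,R)$-bimodule $W$, each firm on both sides, and bimodule maps $\sigma:W\otimes_R V\to S$, $\tau:V\otimes_S W\to R$ such that $\sigma(w\otimes v)w'=w\,\tau(v\otimes w')$ and $\tau(v\otimes w)v'=v\,\sigma(w\otimes v')$ for all $v,v'\in V$, $w,w'\in W$. In this definition, and in (5), tensor products over a non-unital ring $R$ and firmness over it are those of the plain ring: $V\otimes_R W$ is the quotient of $V\otimes_{\mathbb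 Z}W$ by the relations $vr\otimes w=v\otimes rw$. -/

import Mathlib

open CategoryTheory MulOpposite
open scoped RightActions TensorProduct

universe u v w

namespace CoringMorita

/-! ### Tensor products over a (noncommutative, possibly non-unital) ring

Right actions of `R` are actions of `Rᵐᵒᵖ`; `m <• r` is notation for `op r • m`. -/

section BalTensor

/-- The tensor product `M ⊗_R N` of a right `R`-module `M` and a left `R`-module `N`: the quotient
of `M ⊗_ℤ N` by the subgroup generated by all `m r ⊗ n - m ⊗ r n`. -/
def BalTensor (R M N : Type*) [AddCommGroup M] [AddCommGroup N] [SMul Rᵐᵒᵖ M] [SMul R N] :=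
  (M ⊗[ℤ] N) ⧸ AddSubgroup.closure
    {x : M ⊗[ℤ] N | ∃ (m : M) (r : R) (n : N), x = (m <• r) ⊗ₜ[ℤ] n - m ⊗ₜ[ℤ] (r • n)}

namespace BalTensor

variable {R M N P : Type*} [AddCommGroup M] [AddCommGroup N] [SMul Rᵐᵒᵖ M] [SMul R N]
  [AddCommGroup P]

instance : AddCommGroup (BalTensor R M N) := by
  unfold BalTensor
  infer_instance

variable (R) in
/-- The pure tensor `m ⊗ n` in `M ⊗_R N`. -/
def tmul (m : M) (n : N) : BalTensor R M N := QuotientAddGroup.mk (m ⊗ₜ[ℤ] n)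

theorem tmul_add (m : M) (n n' : N) : tmul R m (n + n') = tmul R m n + tmul R m n' := by
  unfold tmul
  rw [TensorProduct.tmul_add]
  rfl

theorem add_tmul (m m' : M) (n : N) : tmul R (m + m') n = tmul R m n + tmul R m' n := by
  unfold tmul
  rw [TensorProduct.add_tmul]
  rfl

theorem zero_tmul (n : N) : tmul R (0 : M) n = 0 := by
  simpa using add_tmul (R := R) (0 : M) 0 n

theorem tmul_zero (m : M) : tmul R m (0 : N) = 0 := by
  simpa using tmul_add (R := R) m (0 : N) 0

theorem smul_tmul (m : M) (r : R) (n : N) : tmul R (m <• r) n = tmul R m (r • n) := by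
  unfold tmul
  refine (QuotientAddGroup.eq_iff_sub_mem).2 (AddSubgroup.subset_closure ⟨m, r, n, rfl⟩)

/-- The additive map `M ⊗_R N → P` induced by a biadditive `R`-balanced map. -/
def lift (f : M → N → P) (hl : ∀ m m' n, f (m + m') n = f m n + f m' n)
    (hr : ∀ m n n', f m (n + n') = f m n + f m n')
    (hb : ∀ m (r : R) n, f (m <• r) n = f m (r • n)) : BalTensor R M N →+ P :=
  QuotientAddGroup.lift _
    (TensorProduct.liftAddHom
      (AddMonoidHom.mk' (fun m => AddMonoidHom.mk' (f m) (hr m)) (fun m m' => by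
        ext n; exact hl m m' n))
      (fun z m n => by simp only [map_zsmul, AddMonoidHom.coe_smul, Pi.smul_apply]))
    (by
      rw [AddSubgroup.closure_le]
      rintro _ ⟨m, r, n, rfl⟩
      simp [hb])

@[simp] theorem lift_tmul (f : M → N → P) (hl hr hb) (m : M) (n : N) :
    lift (R := R) f hl hr hb (tmul R m n) = f m n := rfl

theorem hom_ext {f f' : BalTensor R M N →+ P} (h : ∀ m n, f (tmul R m n) = f' (tmul R m n)) :
    f = f' := by
  refine QuotientAddGroup.addMonoidHom_ext _ ?_
  ext x
  induction x with
  | zero => simp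
  | add x y hx hy => rw [map_add, map_add, hx, hy]
  | tmul m n => exact h m n

/-- Pointwise form of `hom_ext`. -/
theorem hom_ext_apply {f f' : BalTensor R M N →+ P}
    (h : ∀ m n, f (tmul R m n) = f' (tmul R m n)) (x : BalTensor R M N) : f x = f' x := by
  rw [hom_ext h]

/-- `M ⊗ f` for an additive map `f` commuting with the left actions. -/
def lMap {N' : Type*} [AddCommGroup N'] [SMul R N'] (f : N →+ N')
    (hf : ∀ (r : R) n, f (r • n) = r • f n) : BalTensor R M N →+ BalTensor R M N' :=
  lift (fun m n => tmul R m (f n)) (fun _ _ _ => add_tmul _ _ _)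
    (fun _ _ _ => by rw [map_add, tmul_add]) (fun _ _ _ => by rw [smul_tmul, hf])

/-- `f ⊗ N` for an additive map `f` commuting with the right actions. -/
def rMap {M' : Type*} [AddCommGroup M'] [SMul Rᵐᵒᵖ M'] (f : M →+ M')
    (hf : ∀ (r : R) m, f (m <• r) = f m <• r) : BalTensor R M N →+ BalTensor R M' N :=
  lift (fun m n => tmul R (f m) n) (fun _ _ _ => by rw [map_add, add_tmul])
    (fun _ _ _ => tmul_add _ _ _) (fun _ _ _ => by rw [hf, smul_tmul])

@[simp] theorem lMap_tmul {N' : Type*} [AddCommGroup N'] [SMul R N'] (f : N →+ N') (hf)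
    (m : M) (n : N) : lMap (R := R) f hf (tmul R m n) = tmul R m (f n) := rfl

@[simp] theorem rMap_tmul {M' : Type*} [AddCommGroup M'] [SMul Rᵐᵒᵖ M'] (f : M →+ M') (hf)
    (m : M) (n : N) : rMap (R := R) f hf (tmul R m n) = tmul R (f m) n := rfl

/-- Left multiplication by `x`: `m ⊗ n ↦ (x m) ⊗ n`. -/
def lMul {X : Type*} [Ring X] [Module X M] [SMulCommClass X Rᵐᵒᵖ M] (x : X) :
    BalTensor R M N →+ BalTensor R M N :=
  rMap (DistribSMul.toAddMonoidHom M x) (fun r m => smul_comm x (op r) m)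

/-- Right multiplication by `x`: `m ⊗ n ↦ m ⊗ (n x)`. -/
def rMul {X : Type*} [Ring X] [Module Xᵐᵒᵖ N] [SMulCommClass R Xᵐᵒᵖ N] (x : Xᵐᵒᵖ) :
    BalTensor R M N →+ BalTensor R M N :=
  lMap (DistribSMul.toAddMonoidHom N x) (fun r n => (smul_comm r x n).symm)

/-- `x (m ⊗ n) = (x m) ⊗ n`. -/
instance leftModule {X : Type*} [Ring X] [Module X M] [SMulCommClass X Rᵐᵒᵖ M] :
    Module X (BalTensor R M N) where
  smul x := lMul x
  one_smul t := hom_ext_apply (f := lMul (1 : X)) (f' := AddMonoidHom.id _)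
    (fun m n => congrArg (fun z => tmul R z n) (one_smul X m)) t
  mul_smul x y t := hom_ext_apply (f := lMul (x * y)) (f' := (lMul x).comp (lMul y))
    (fun m n => congrArg (fun z => tmul R z n) (mul_smul x y m)) t
  smul_zero x := map_zero (lMul x)
  smul_add x := map_add (lMul x)
  add_smul x y t := hom_ext_apply (f := lMul (x + y)) (f' := lMul x + lMul y)
    (fun m n => (congrArg (fun z => tmul R z n) (add_smul x y m)).trans (add_tmul _ _ _)) t
  zero_smul t := hom_ext_apply (f := lMul (0 : X))
    (f' := (0 : BalTensor R M N →+ BalTensor R M N))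
    (fun m n => (congrArg (fun z => tmul R z n) (zero_smul X m)).trans (zero_tmul n)) t

/-- `(m ⊗ n) x = m ⊗ (n x)`. -/
instance rightModule {X : Type*} [Ring X] [Module Xᵐᵒᵖ N] [SMulCommClass R Xᵐᵒᵖ N] :
    Module Xᵐᵒᵖ (BalTensor R M N) where
  smul x := rMul x
  one_smul t := hom_ext_apply (f := rMul (1 : Xᵐᵒᵖ)) (f' := AddMonoidHom.id _)
    (fun m n => congrArg (tmul R m) (one_smul _ n)) t
  mul_smul x y t := hom_ext_apply (f := rMul (x * y)) (f' := (rMul x).comp (rMul y))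
    (fun m n => congrArg (tmul R m) (mul_smul x y n)) t
  smul_zero x := map_zero (rMul x)
  smul_add x := map_add (rMul x)
  add_smul x y t := hom_ext_apply (f := rMul (x + y)) (f' := rMul x + rMul y)
    (fun m n => (congrArg (tmul R m) (add_smul x y n)).trans (tmul_add _ _ _)) t
  zero_smul t := hom_ext_apply (f := rMul (0 : Xᵐᵒᵖ))
    (f' := (0 : BalTensor R M N →+ BalTensor R M N))
    (fun m n => (congrArg (tmul R m) (zero_smul _ n)).trans (tmul_zero m)) t

theorem smul_def {X : Type*} [Ring X] [Module X M] [SMulCommClass X Rᵐᵒᵖ M] (x : X) (m : M)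
    (n : N) : x • tmul R m n = tmul R (x • m) n := rfl

theorem op_smul_def {X : Type*} [Ring X] [Module Xᵐᵒᵖ N] [SMulCommClass R Xᵐᵒᵖ N] (x : X) (m : M)
    (n : N) : (tmul R m n) <• x = tmul R m (n <• x) := rfl

/-- The associativity map `(M ⊗_A N) ⊗_A P → M ⊗_A (N ⊗_A P)`. -/
def assoc (A M N P : Type*) [Ring A] [AddCommGroup M] [AddCommGroup N] [AddCommGroup P]
    [Module Aᵐᵒᵖ M] [Module A N] [Module Aᵐᵒᵖ N] [SMulCommClass A Aᵐᵒᵖ N] [Module A P] :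
    BalTensor A (BalTensor A M N) P →+ BalTensor A M (BalTensor A N P) :=
  let F : P → BalTensor A M N →+ BalTensor A M (BalTensor A N P) := fun p =>
    lift (R := A) (fun m n => tmul A m (tmul A n p))
      (fun _ _ _ => add_tmul _ _ _)
      (fun _ _ _ => by rw [add_tmul, tmul_add])
      (fun m r n => by rw [smul_tmul, smul_def])
  lift (fun t p => F p t)
    (fun t t' p => map_add (F p) t t')
    (fun t p p' => hom_ext_apply (f := F (p + p')) (f' := F p + F p')
      (fun m n => by
        change tmul A m (tmul A n (p + p')) = tmul A m (tmul A n p) + tmul A m (tmul A n p')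
        rw [tmul_add, tmul_add]) t)
    (fun t a p => hom_ext_apply (f := (F p).comp (rMul (op a))) (f' := F (a • p))
      (fun m n => by
        change tmul A m (tmul A (n <• a) p) = tmul A m (tmul A n (a • p))
        rw [smul_tmul]) t)

end BalTensor

end BalTensor

open BalTensor

/-! ### Corings, cointegrals, grouplike elements -/

section Coring

/-- Homomorphisms of `(A, A)`-bimodules. -/
structure BimoduleHom (A M N : Type*) [Ring A] [AddCommGroup M] [AddCommGroup N] [Module A M]
    [Module Aᵐᵒᵖ M] [Module A N] [Module Aᵐᵒᵖ N] extends M →+ N where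
  map_left : ∀ (a : A) m, toFun (a • m) = a • toFun m
  map_right : ∀ (a : A) m, toFun (m <• a) = toFun m <• a

instance (A M N : Type*) [Ring A] [AddCommGroup M] [AddCommGroup N] [Module A M]
    [Module Aᵐᵒᵖ M] [Module A N] [Module Aᵐᵒᵖ N] : CoeFun (BimoduleHom A M N) (fun _ => M → N) :=
  ⟨fun f => f.toFun⟩

/-- An `A`-coring structure on the `(A, A)`-bimodule `C`: a coassociative bimodule map
`Δ : C → C ⊗_A C` with a bimodule counit `ε : C → A`. -/
class Coring (A C : Type*) [Ring A] [AddCommGroup C] [Module A C] [Module Aᵐᵒᵖ C]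
    [SMulCommClass A Aᵐᵒᵖ C] where
  comul : BimoduleHom A C (BalTensor A C C)
  counit : BimoduleHom A C A
  coassoc : ∀ c, lMap comul.toAddMonoidHom comul.map_left (comul c) =
    BalTensor.assoc A C C C (rMap comul.toAddMonoidHom comul.map_right (comul c))
  counit_left : ∀ c, lift (R := A) (P := C) (fun x y => counit x • y)
    (fun x x' y => by
      rw [show counit (x + x') = counit x + counit x' from counit.map_add' x x', add_smul])
    (fun _ _ _ => smul_add _ _ _)
    (fun x a y => by rw [counit.map_right, op_smul_eq_mul, mul_smul]) (comul c) = c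
  counit_right : ∀ c, lift (R := A) (P := C) (fun x y => x <• counit y)
    (fun _ _ _ => smul_add _ _ _)
    (fun x y y' => by
      rw [show counit (y + y') = counit y + counit y' from counit.map_add' y y', MulOpposite.op_add,
        add_smul])
    (fun x a y => by rw [counit.map_left, smul_eq_mul, op_mul, mul_smul]) (comul c) = c

variable {A : Type u} {C : Type w} [Ring A] [AddCommGroup C] [Module A C] [Module Aᵐᵒᵖ C]
  [SMulCommClass A Aᵐᵒᵖ C]

/-- For a bimodule map `γ : C ⊗_A C → A` and `c : C`, the map `x ⊗ y ↦ γ(c ⊗ x) y`. -/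
def contractLeft (γ : BimoduleHom A (BalTensor A C C) A) (c : C) : BalTensor A C C →+ C :=
  lift (fun x y => γ (tmul A c x) • y)
    (fun x x' y => by
      rw [tmul_add, show γ (tmul A c x + tmul A c x') = γ (tmul A c x) + γ (tmul A c x') from
        γ.map_add' _ _, add_smul])
    (fun _ _ _ => smul_add _ _ _)
    (fun x a y => by rw [← op_smul_def, γ.map_right, op_smul_eq_mul, mul_smul])

/-- For a bimodule map `γ : C ⊗_A C → A` and `c : C`, the map `x ⊗ y ↦ x γ(y ⊗ c)`. -/
def contractRight (γ : BimoduleHom A (BalTensor A C C) A) (c : C) : BalTensor A C C →+ C :=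
  lift (fun x y => x <• γ (tmul A y c))
    (fun _ _ _ => smul_add _ _ _)
    (fun x y y' => by
      rw [add_tmul, show γ (tmul A y c + tmul A y' c) = γ (tmul A y c) + γ (tmul A y' c) from
        γ.map_add' _ _, MulOpposite.op_add, add_smul])
    (fun x a y => by rw [← smul_def, γ.map_left, smul_eq_mul, op_mul, mul_smul])

variable (A C) in
/-- A cointegral in the coring `C`: a bimodule map `γ : C ⊗_A C → A` with
`∑ γ(c ⊗ c'₁) c'₂ = ∑ c₁ γ(c₂ ⊗ c')` and `∑ γ(c₁ ⊗ c₂) = ε(c)`. -/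
structure Cointegral [Coring A C] where
  toHom : BimoduleHom A (BalTensor A C C) A
  colinear : ∀ c c' : C, contractLeft toHom c (Coring.comul (A := A) c') =
    contractRight toHom c' (Coring.comul (A := A) c)
  normalized : ∀ c : C, toHom (Coring.comul c) = Coring.counit c

variable (A C) in
/-- A grouplike element: `Δ(g) = g ⊗ g` and `ε(g) = 1`. -/
structure Grouplike [Coring A C] where
  val : C
  comul_eq : Coring.comul (A := A) val = tmul A val val
  counit_eq : Coring.counit (A := A) val = 1

end Coring

/-! ### Non-unital rings, `A`-rings, firm modules, Morita contexts -/

section ARing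

/-- The axioms of a left module over a non-unital ring (right modules: over `Rᵐᵒᵖ`). -/
class IsNonUnitalModule (R M : Type*) [NonUnitalRing R] [AddCommGroup M] [SMul R M] : Prop where
  smul_add : ∀ (r : R) (m m' : M), r • (m + m') = r • m + r • m'
  add_smul : ∀ (r r' : R) (m : M), (r + r') • m = r • m + r' • m
  mul_smul : ∀ (r r' : R) (m : M), (r * r') • m = r • r' • m

/-- A right module `M` over a non-unital ring `R` is firm if `M ⊗_R R → M`, `m ⊗ r ↦ m r`, is an
isomorphism. -/
def IsFirmRight (R M : Type*) [NonUnitalRing R] [AddCommGroup M] [SMul Rᵐᵒᵖ M] : Prop :=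
  ∃ e : BalTensor R M R ≃+ M, ∀ m (r : R), e (tmul R m r) = m <• r

/-- A left module `M` over a non-unital ring `R` is firm if `R ⊗_R M → M`, `r ⊗ m ↦ r m`, is an
isomorphism. -/
def IsFirmLeft (R M : Type*) [NonUnitalRing R] [AddCommGroup M] [SMul R M] : Prop :=
  ∃ e : BalTensor R R M ≃+ M, ∀ (r : R) m, e (tmul R r m) = r • m

/-- A Morita context `(R, S, V, W, τ, σ)` between firm non-unital rings `R` and `S`. -/
structure MoritaContext (R S V W : Type*) [NonUnitalRing R] [NonUnitalRing S]
    [AddCommGroup V] [AddCommGroup W] [SMul R V] [SMul Sᵐᵒᵖ V] [SMul S W] [SMul Rᵐᵒᵖ W] where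
  firm_R_left : IsFirmLeft R R
  firm_R_right : IsFirmRight R R
  firm_S_left : IsFirmLeft S S
  firm_S_right : IsFirmRight S S
  /-- `V` is a firm `(R, S)`-bimodule -/
  V_left : IsNonUnitalModule R V
  V_right : IsNonUnitalModule Sᵐᵒᵖ V
  V_comm : SMulCommClass R Sᵐᵒᵖ V
  V_firm_left : IsFirmLeft R V
  V_firm_right : IsFirmRight S V
  /-- `W` is a firm `(S, R)`-bimodule -/
  W_left : IsNonUnitalModule S W
  W_right : IsNonUnitalModule Rᵐᵒᵖ W
  W_comm : SMulCommClass S Rᵐᵒᵖ W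
  W_firm_left : IsFirmLeft S W
  W_firm_right : IsFirmRight R W
  /-- the `(S, S)`-bimodule map `W ⊗_R V → S` -/
  σ : BalTensor R W V →+ S
  σ_left : ∀ (s : S) w v, σ (tmul R (s • w) v) = s * σ (tmul R w v)
  σ_right : ∀ (s : S) w v, σ (tmul R w (v <• s)) = σ (tmul R w v) * s
  /-- the `(R, R)`-bimodule map `V ⊗_S W → R` -/
  τ : BalTensor S V W →+ R
  τ_left : ∀ (r : R) v w, τ (tmul S (r • v) w) = r * τ (tmul S v w)
  τ_right : ∀ (r : R) v w, τ (tmul S v (w <• r)) = τ (tmul S v w) * r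
  σ_smul : ∀ w v w', σ (tmul R w v) • w' = w <• τ (tmul S v w')
  τ_smul : ∀ v w v', τ (tmul S v w) • v' = v <• σ (tmul R w v')

/-- `S` is an `A`-ring: a (non-unital) ring and an `(A, A)`-bimodule whose product is an
`A`-balanced `(A, A)`-bimodule map. -/
class ARing (A S : Type*) [Ring A] [NonUnitalRing S] [Module A S] [Module Aᵐᵒᵖ S] : Prop
    extends SMulCommClass A Aᵐᵒᵖ S where
  smul_mul : ∀ (a : A) (s t : S), (a • s) * t = a • (s * t)
  mul_smul_right : ∀ (a : A) (s t : S), s * (t <• a) = (s * t) <• a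
  balanced : ∀ (a : A) (s t : S), (s <• a) * t = s * (a • t)

/-- The axioms of a right module over an `A`-ring `S`: a right `A`-module `M` with an associative
right `A`-linear action `M ⊗_A S → M`. -/
class IsRightModule (A S M : Type*) [Ring A] [NonUnitalRing S] [Module A S] [Module Aᵐᵒᵖ S]
    [AddCommGroup M] [Module Aᵐᵒᵖ M] [SMul Sᵐᵒᵖ M] : Prop extends IsNonUnitalModule Sᵐᵒᵖ M where
  balanced : ∀ (m : M) (a : A) (s : S), (m <• a) <• s = m <• (a • s)
  linear : ∀ (m : M) (a : A) (s : S), (m <• s) <• a = m <• (s <• a)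

/-- The axioms of a left module over an `A`-ring `S`. -/
class IsLeftModule (A S M : Type*) [Ring A] [NonUnitalRing S] [Module A S] [Module Aᵐᵒᵖ S]
    [AddCommGroup M] [Module A M] [SMul S M] : Prop extends IsNonUnitalModule S M where
  balanced : ∀ (m : M) (a : A) (s : S), s • a • m = (s <• a) • m
  linear : ∀ (m : M) (a : A) (s : S), a • s • m = (a • s) • m

/-- The tensor product `M ⊗_S N` over an `A`-ring `S`: the cokernel of
`M ⊗_A S ⊗_A N → M ⊗_A N`, `m ⊗ s ⊗ n ↦ m s ⊗ n - m ⊗ s n`. -/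
def RingTensor (A S M N : Type*) [Ring A] [AddCommGroup M] [AddCommGroup N] [Module Aᵐᵒᵖ M]
    [Module A N] [SMul Sᵐᵒᵖ M] [SMul S N] :=
  BalTensor A M N ⧸ AddSubgroup.closure
    {x : BalTensor A M N | ∃ (m : M) (s : S) (n : N),
      x = tmul A (m <• s) n - tmul A m (s • n)}

namespace RingTensor

variable {A S M N : Type*} [Ring A] [AddCommGroup M] [AddCommGroup N] [Module Aᵐᵒᵖ M]
    [Module A N] [SMul Sᵐᵒᵖ M] [SMul S N]

instance : AddCommGroup (RingTensor A S M N) := by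
  unfold RingTensor
  infer_instance

variable (A S) in
/-- The pure tensor `m ⊗ n` in `M ⊗_S N`. -/
def tmul (m : M) (n : N) : RingTensor A S M N := QuotientAddGroup.mk (BalTensor.tmul A m n)

end RingTensor

variable (A : Type u) (S : Type w) [Ring A] [NonUnitalRing S] [Module A S] [Module Aᵐᵒᵖ S]

/-- The type of right modules over the `A`-ring `S`. -/
structure RightModCat where
  carrier : Type v
  [addCommGroup : AddCommGroup carrier]
  [module : Module Aᵐᵒᵖ carrier]
  [smul : SMul Sᵐᵒᵖ carrier]
  [isRightModule : IsRightModule A S carrier]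

namespace RightModCat

instance : CoeSort (RightModCat.{u, v, w} A S) (Type v) := ⟨carrier⟩

attribute [instance] addCommGroup module smul isRightModule

variable {A S}

/-- Morphisms of right `S`-modules: right `A`-linear maps commuting with the `S`-actions. -/
@[ext]
structure Hom (M N : RightModCat.{u, v, w} A S) where
  toLinearMap : M →ₗ[Aᵐᵒᵖ] N
  map_smul : ∀ (m : M) (s : S), toLinearMap (m <• s) = toLinearMap m <• s

instance : Category (RightModCat.{u, v, w} A S) where
  Hom := Hom
  id M := ⟨LinearMap.id, fun _ _ => rfl⟩
  comp f f' := ⟨f'.toLinearMap.comp f.toLinearMap, fun m s => by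
    rw [LinearMap.comp_apply, LinearMap.comp_apply, f.map_smul, f'.map_smul]⟩

/-- The right `S`-module `M` is firm: `M ⊗_S S → M`, `m ⊗ s ↦ m s`, is an isomorphism, where
`⊗_S` is the tensor product over the `A`-ring `S`. -/
def IsFirm : ObjectProperty (RightModCat.{u, v, w} A S) := fun M =>
  ∃ e : RingTensor A S M S ≃+ M, ∀ (m : M) (s : S), e (RingTensor.tmul A S m s) = m <• s

end RightModCat

/-- The left module `M` over the `A`-ring `S` is firm: `S ⊗_S M → M`, `s ⊗ m ↦ s m`, is an
isomorphism, where `⊗_S` is the tensor product over the `A`-ring `S`. -/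
def IsFirmLeftModule (M : Type*) [AddCommGroup M] [Module A M] [SMul S M] : Prop :=
  ∃ e : RingTensor A S S M ≃+ M, ∀ (s : S) (m : M), e (RingTensor.tmul A S s m) = s • m

end ARing

/-! ### The `A`-ring of a coseparable coring -/

section CosepRing

variable {A : Type u} {C : Type w} [Ring A] [AddCommGroup C] [Module A C] [Module Aᵐᵒᵖ C]
  [SMulCommClass A Aᵐᵒᵖ C] [Coring A C]

namespace Cointegral

/-- `γ(c ⊗ c')`. -/
def pair (γ : Cointegral A C) (c c' : C) : A := γ.toHom (tmul A c c')

variable (γ : Cointegral A C)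

theorem pair_add_left (c d c' : C) : γ.pair (c + d) c' = γ.pair c c' + γ.pair d c' := by
  unfold pair; rw [add_tmul]; exact γ.toHom.map_add' _ _

theorem pair_add_right (c c' d : C) : γ.pair c (c' + d) = γ.pair c c' + γ.pair c d := by
  unfold pair; rw [tmul_add]; exact γ.toHom.map_add' _ _

theorem pair_smul_left (a : A) (c c' : C) : γ.pair (a • c) c' = a * γ.pair c c' :=
  γ.toHom.map_left a (tmul A c c')

theorem pair_smul_right (a : A) (c c' : C) : γ.pair c (c' <• a) = γ.pair c c' * a :=
  γ.toHom.map_right a (tmul A c c')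

theorem pair_balanced (a : A) (c c' : C) : γ.pair (c <• a) c' = γ.pair c (a • c') := by
  unfold pair; rw [smul_tmul]

/-- The product `c c' = ∑ c₁ γ(c₂ ⊗ c')` on `C`. -/
def prod (c c' : C) : C := contractRight γ.toHom c' (Coring.comul (A := A) c)

theorem prod_eq_left (c c' : C) :
    γ.prod c c' = contractLeft γ.toHom c (Coring.comul (A := A) c') := (γ.colinear c c').symm

theorem prod_add_left (c d c' : C) : γ.prod (c + d) c' = γ.prod c c' + γ.prod d c' := by
  unfold prod
  rw [show Coring.comul (A := A) (c + d) = Coring.comul c + Coring.comul d from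
    Coring.comul.map_add' c d, map_add]

theorem prod_add_right (c c' d : C) : γ.prod c (c' + d) = γ.prod c c' + γ.prod c d := by
  rw [prod_eq_left, prod_eq_left, prod_eq_left,
    show Coring.comul (A := A) (c' + d) = Coring.comul c' + Coring.comul d from
    Coring.comul.map_add' c' d, map_add]

theorem prod_smul_left (a : A) (c c' : C) : γ.prod (a • c) c' = a • γ.prod c c' := by
  unfold prod
  rw [Coring.comul.map_left]
  exact hom_ext_apply (f := (contractRight γ.toHom c').comp (DistribSMul.toAddMonoidHom _ a))
    (f' := (DistribSMul.toAddMonoidHom C a).comp (contractRight γ.toHom c'))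
    (fun x y => (smul_comm a (op (γ.pair y c')) x).symm) _

theorem prod_smul_right (a : A) (c c' : C) : γ.prod c (c' <• a) = γ.prod c c' <• a := by
  rw [prod_eq_left, prod_eq_left, Coring.comul.map_right]
  exact hom_ext_apply
    (f := (contractLeft γ.toHom c).comp (DistribSMul.toAddMonoidHom _ (op a)))
    (f' := (DistribSMul.toAddMonoidHom C (op a)).comp (contractLeft γ.toHom c))
    (fun x y => smul_comm (γ.pair c x) (op a) y) _

theorem prod_balanced (a : A) (c c' : C) : γ.prod (c <• a) c' = γ.prod c (a • c') := by
  unfold prod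
  rw [Coring.comul.map_right]
  exact hom_ext_apply
    (f := (contractRight γ.toHom c').comp (DistribSMul.toAddMonoidHom _ (op a)))
    (f' := contractRight γ.toHom (a • c'))
    (fun x y => congrArg (fun z => x <• z) (γ.pair_balanced a y c')) _

/-- `γ(x c ⊗ c') = γ(x ⊗ c c')`. -/
theorem pair_prod (x c c' : C) : γ.pair (γ.prod x c) c' = γ.pair x (γ.prod c c') := by
  rw [prod_eq_left]
  unfold prod
  exact hom_ext_apply
    (f := (AddMonoidHom.mk' (fun z => γ.pair z c') (fun y z => γ.pair_add_left y z c')).comp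
      (contractLeft γ.toHom x))
    (f' := (AddMonoidHom.mk' (fun z => γ.pair x z) (fun y z => γ.pair_add_right x y z)).comp
      (contractRight γ.toHom c'))
    (fun y z => (γ.pair_smul_left (γ.pair x y) z c').trans
      (γ.pair_smul_right (γ.pair z c') x y).symm) _

/-- `Δ(c c') = ∑ c₁ ⊗ c₂ c'`. -/
theorem comul_prod (c c' : C) : Coring.comul (A := A) (γ.prod c c') =
    lMap (AddMonoidHom.mk' (fun z => γ.prod z c') (fun y z => γ.prod_add_left y z c'))
      (fun a z => γ.prod_smul_left a z c') (Coring.comul (A := A) c) := by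
  let D : C →+ BalTensor A C C := Coring.comul.toAddMonoidHom
  let E : BalTensor A C (BalTensor A C C) →+ BalTensor A C C :=
    lMap (contractRight γ.toHom c') (fun a t => hom_ext_apply
      (f := (contractRight γ.toHom c').comp (DistribSMul.toAddMonoidHom _ a))
      (f' := (DistribSMul.toAddMonoidHom C a).comp (contractRight γ.toHom c'))
      (fun x y => (smul_comm a (op (γ.pair y c')) x).symm) t)
  have h1 : lMap (AddMonoidHom.mk' (fun z => γ.prod z c') (fun y z => γ.prod_add_left y z c'))
      (fun a z => γ.prod_smul_left a z c') (Coring.comul (A := A) c) =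
      E (lMap D Coring.comul.map_left (Coring.comul (A := A) c)) :=
    hom_ext_apply (f := lMap _ _) (f' := E.comp (lMap D _)) (fun x y => rfl) _
  rw [h1, Coring.coassoc]
  change D (contractRight γ.toHom c' (Coring.comul (A := A) c)) = _
  refine hom_ext_apply (f := D.comp (contractRight γ.toHom c'))
    (f' := (E.comp (BalTensor.assoc A C C C)).comp (rMap D Coring.comul.map_right))
    (fun x y => ?_) _
  change Coring.comul (A := A) (x <• γ.pair y c') =
    E (BalTensor.assoc A C C C (tmul A (Coring.comul x) y))
  rw [Coring.comul.map_right]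
  exact hom_ext_apply
    (f := DistribSMul.toAddMonoidHom (BalTensor A C C) (op (γ.pair y c')))
    (f' := (E.comp (BalTensor.assoc A C C C)).comp
      (AddMonoidHom.mk' (fun t => tmul A t y) (fun s t => add_tmul s t y)))
    (fun s t => rfl) _

theorem prod_assoc (c c' c'' : C) : γ.prod (γ.prod c c') c'' = γ.prod c (γ.prod c' c'') := by
  rw [prod_eq_left γ c (γ.prod c' c''), comul_prod, prod_eq_left γ c c']
  exact hom_ext_apply
    (f := (AddMonoidHom.mk' (fun z => γ.prod z c'') (fun y z => γ.prod_add_left y z c'')).comp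
      (contractLeft γ.toHom c))
    (f' := (contractLeft γ.toHom c).comp
      (lMap (AddMonoidHom.mk' (fun z => γ.prod z c'') (fun y z => γ.prod_add_left y z c''))
        (fun a z => γ.prod_smul_left a z c'')))
    (fun x y => γ.prod_smul_left (γ.pair c x) y c'') _

/-- The coring `C` viewed as an `A`-ring, with product `c c' = ∑ c₁ γ(c₂ ⊗ c')`. -/
def AsRing (_γ : Cointegral A C) : Type w := C

/-- The identity map from the `A`-ring to the coring. -/
def toC (c : γ.AsRing) : C := c

instance : NonUnitalRing γ.AsRing :=
  { (inferInstanceAs (AddCommGroup C) : AddCommGroup γ.AsRing) with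
    mul := γ.prod
    left_distrib := γ.prod_add_right
    right_distrib := γ.prod_add_left
    zero_mul := fun c => (AddMonoidHom.mk' (fun z => γ.prod z c)
      (fun y z => γ.prod_add_left y z c)).map_zero
    mul_zero := fun c => (AddMonoidHom.mk' (γ.prod c) (γ.prod_add_right c)).map_zero
    mul_assoc := γ.prod_assoc }

instance : Module A γ.AsRing := inferInstanceAs (Module A C)

instance : Module Aᵐᵒᵖ γ.AsRing := inferInstanceAs (Module Aᵐᵒᵖ C)

instance : ARing A γ.AsRing where
  smul_comm := fun a b (c : C) => smul_comm a b c
  smul_mul := γ.prod_smul_left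
  mul_smul_right := fun a s t => γ.prod_smul_right a s t
  balanced := γ.prod_balanced

/-- `C` as a right module over the `A`-ring `C`. -/
instance : IsRightModule A γ.AsRing γ.AsRing where
  smul_add := fun _ _ _ => add_mul _ _ _
  add_smul := fun _ _ _ => mul_add _ _ _
  mul_smul := fun _ _ _ => (mul_assoc _ _ _).symm
  balanced := fun m a s => ARing.balanced a m s
  linear := fun m a s => (ARing.mul_smul_right a m s).symm

end Cointegral

variable (γ : Cointegral A C) (g : Grouplike A C)

/-- `A` as a right `C`-module with the action `a · c = γ(g a ⊗ c)`. -/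
def GModule (_γ : Cointegral A C) (_g : Grouplike A C) : Type u := A

namespace GModule

/-- The identity map from `A` to the module `A`. -/
def of (a : A) : GModule γ g := a

instance : AddCommGroup (GModule γ g) := inferInstanceAs (AddCommGroup A)

instance : Module A (GModule γ g) := inferInstanceAs (Module A A)

instance : Module Aᵐᵒᵖ (GModule γ g) := inferInstanceAs (Module Aᵐᵒᵖ A)

instance : SMulCommClass A Aᵐᵒᵖ (GModule γ g) := inferInstanceAs (SMulCommClass A Aᵐᵒᵖ A)

instance : SMul (γ.AsRing)ᵐᵒᵖ (GModule γ g) where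
  smul c a := (γ.pair (g.val <• (show A from a)) (γ.toC (unop c)) : A)

/-- `(g a) c = g γ(g a ⊗ c)`. -/
theorem prod_eq (a : A) (c : C) :
    γ.prod (g.val <• a) c = g.val <• γ.pair (g.val <• a) c := by
  unfold Cointegral.prod
  rw [Coring.comul.map_right, g.comul_eq]
  rfl

instance : IsRightModule A γ.AsRing (GModule γ g) where
  smul_add c a b := by
    change γ.pair (g.val <• ((show A from a) + (show A from b))) _ = γ.pair _ _ + γ.pair _ _
    rw [MulOpposite.op_add, add_smul, γ.pair_add_left]
  add_smul c d a := γ.pair_add_right _ _ _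
  mul_smul c d a := by
    change γ.pair (g.val <• (show A from a)) (γ.prod (unop d) (unop c)) =
      γ.pair (g.val <• γ.pair (g.val <• (show A from a)) (unop d)) (unop c)
    rw [← prod_eq, γ.pair_prod]
  balanced m a s := by
    change γ.pair (g.val <• ((show A from m) * a)) _ =
      γ.pair (g.val <• (show A from m)) (a • γ.toC s)
    rw [op_mul, mul_smul, γ.pair_balanced]
    rfl
  linear m a s := (γ.pair_smul_right a _ _).symm

end GModule

/-- `B = {b ∈ A | γ(g b ⊗ c) = b γ(g ⊗ c) for all c}`, a subring of `A`. -/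
def B : Subring A where
  carrier := {b | ∀ c : C, γ.pair (g.val <• b) c = b * γ.pair g.val c}
  zero_mem' c := by
    have h := γ.pair_add_left 0 0 c
    simp only [add_zero, left_eq_add] at h
    simp [h]
  one_mem' c := by simp
  add_mem' {a b} ha hb c := by
    rw [MulOpposite.op_add, add_smul, γ.pair_add_left, ha c, hb c, add_mul]
  neg_mem' {a} ha c := by
    have h := γ.pair_add_left (g.val <• a) (g.val <• (-a)) c
    have h0 := γ.pair_add_left 0 0 c
    simp only [add_zero, left_eq_add] at h0
    rw [← add_smul, ← MulOpposite.op_add, add_neg_cancel, op_zero, zero_smul, h0, ha c] at h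
    rw [neg_mul]
    exact (neg_eq_of_add_eq_zero_right h.symm).symm
  mul_mem' {a b} ha hb c := by
    rw [op_mul, mul_smul, γ.pair_balanced, ha, ← γ.pair_balanced, hb, mul_assoc]

section Invariants

variable (M : Type*) [AddCommGroup M] [Module Aᵐᵒᵖ M] [SMul (γ.AsRing)ᵐᵒᵖ M]
  [IsRightModule A γ.AsRing M]

/-- `M_{g,γ}^C = {m ∈ M | m · c = m γ(g ⊗ c) for all c}`. -/
def invariants : AddSubgroup M where
  carrier := {m | ∀ c : γ.AsRing, m <• c = m <• γ.pair g.val (γ.toC c)}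
  zero_mem' c := by
    have h := IsNonUnitalModule.smul_add (op c) (0 : M) 0
    simp only [add_zero, left_eq_add] at h
    rw [h, smul_zero]
  add_mem' {a b} ha hb c := by
    rw [IsNonUnitalModule.smul_add, ha c, hb c, smul_add]
  neg_mem' {a} ha c := by
    have h := IsNonUnitalModule.smul_add (op c) a (-a)
    have h0 := IsNonUnitalModule.smul_add (op c) (0 : M) 0
    simp only [add_zero, left_eq_add] at h0
    rw [add_neg_cancel, h0, ha c] at h
    rw [smul_neg]
    exact (neg_eq_of_add_eq_zero_right h.symm).symm

variable {M} in
theorem invariants_smul_mem (b : B γ g) {m : M} (hm : m ∈ invariants γ g M) : m <• (b : A) ∈ invariants γ g M := by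
  intro c
  rw [IsRightModule.balanced, hm, smul_smul, ← op_mul]
  congr 2
  change γ.pair g.val ((b : A) • γ.toC c) = _
  rw [← γ.pair_balanced, b.2]

/-- `M_{g,γ}^C` is a right `B`-module with the action inherited from the right `A`-module `M`. -/
instance : Module (B γ g)ᵐᵒᵖ (invariants γ g M) where
  smul b m := ⟨(m : M) <• ((unop b : B γ g) : A), invariants_smul_mem γ g _ m.2⟩
  one_smul m := Subtype.ext (one_smul Aᵐᵒᵖ (m : M))
  mul_smul a b m := Subtype.ext (mul_smul (op ((unop a : B γ g) : A)) (op ((unop b : B γ g) : A))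
    (m : M))
  smul_zero b := Subtype.ext (smul_zero (op ((unop b : B γ g) : A)))
  smul_add b m n := Subtype.ext (smul_add (op ((unop b : B γ g) : A)) (m : M) (n : M))
  add_smul a b m := Subtype.ext (add_smul (op ((unop a : B γ g) : A)) (op ((unop b : B γ g) : A))
    (m : M))
  zero_smul m := Subtype.ext (zero_smul Aᵐᵒᵖ (m : M))

end Invariants

/-- The functor `M ↦ M_{g,γ}^C` from right `C`-modules to right `B`-modules, acting on morphisms
by restriction. -/
def invFunctor : RightModCat.{u, v, w} A γ.AsRing ⥤ ModuleCat.{v} (B γ g)ᵐᵒᵖ where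
  obj M := ModuleCat.of _ (invariants γ g M)
  map {M N} f := ModuleCat.ofHom
    { toFun := fun m => ⟨f.toLinearMap m, fun c => by
        rw [← f.map_smul, m.2 c, map_smul]⟩
      map_add' := fun m n => Subtype.ext (f.toLinearMap.map_add m n)
      map_smul' := fun b m => Subtype.ext
        (f.toLinearMap.map_smul (op ((unop b : B γ g) : A)) (m : M)) }

section TensorFunctor

/-- `A` is a `(B, C)`-bimodule. -/
instance : SMulCommClass (B γ g) (γ.AsRing)ᵐᵒᵖ (GModule γ g) where
  smul_comm b c a := by
    change (b : A) * γ.pair (g.val <• (show A from a)) (unop c) =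
      γ.pair (g.val <• ((b : A) * (show A from a))) (unop c)
    rw [op_mul, mul_smul, γ.pair_balanced, γ.pair_balanced, b.2]

variable (N : Type*) [AddCommGroup N] [Module (B γ g)ᵐᵒᵖ N]

/-- The map `n ⊗ a ↦ n ⊗ (a · c)` on `N ⊗_B A`. -/
def act (c : (γ.AsRing)ᵐᵒᵖ) :
    BalTensor (B γ g) N (GModule γ g) →+ BalTensor (B γ g) N (GModule γ g) :=
  lMap
    (AddMonoidHom.mk' (fun a : GModule γ g => c • a)
      (fun a b => IsNonUnitalModule.smul_add c a b))
    (fun b a => (smul_comm b c a).symm)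

/-- The right `C`-action on `N ⊗_B A`: `(n ⊗ a) · c = n ⊗ (a · c)`. -/
instance : SMul (γ.AsRing)ᵐᵒᵖ (BalTensor (B γ g) N (GModule γ g)) where
  smul c := act γ g N c

instance : IsRightModule A γ.AsRing (BalTensor (B γ g) N (GModule γ g)) where
  smul_add c := map_add (act γ g N c)
  add_smul c d t := hom_ext_apply (f := act γ g N (c + d)) (f' := act γ g N c + act γ g N d)
    (fun n a => (congrArg (tmul (B γ g) n) (IsNonUnitalModule.add_smul c d a)).trans
      (tmul_add _ _ _)) t
  mul_smul c d t := hom_ext_apply (f := act γ g N (c * d))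
    (f' := (act γ g N c).comp (act γ g N d))
    (fun n a => congrArg (tmul (B γ g) n) (IsNonUnitalModule.mul_smul c d a)) t
  balanced t a s := hom_ext_apply (f := (act γ g N (op s)).comp (rMul (op a)))
    (f' := act γ g N (op (a • s)))
    (fun n x => congrArg (tmul (B γ g) n) (IsRightModule.balanced x a s)) t
  linear t a s := hom_ext_apply (f := (rMul (op a)).comp (act γ g N (op s)))
    (f' := act γ g N (op (s <• a)))
    (fun n x => congrArg (tmul (B γ g) n) (IsRightModule.linear x a s)) t

end TensorFunctor

/-- The map `f ⊗_B A : N ⊗_B A → N' ⊗_B A`. -/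
def tensorMap {N N' : Type*} [AddCommGroup N] [AddCommGroup N'] [Module (B γ g)ᵐᵒᵖ N]
    [Module (B γ g)ᵐᵒᵖ N'] (f : N →ₗ[(B γ g)ᵐᵒᵖ] N') :
    BalTensor (B γ g) N (GModule γ g) →+ BalTensor (B γ g) N' (GModule γ g) :=
  rMap f.toAddMonoidHom (fun b n => f.map_smul (op b) n)

/-- The functor `N ↦ N ⊗_B A` from right `B`-modules to right `C`-modules. -/
def tensorFunctor :
    ModuleCat.{max u v} (B γ g)ᵐᵒᵖ ⥤ RightModCat.{u, max u v, w} A γ.AsRing where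
  obj N := ⟨BalTensor (B γ g) N (GModule γ g)⟩
  map {N N'} f :=
    { toLinearMap :=
        { toFun := tensorMap γ g f.hom
          map_add' := map_add _
          map_smul' := fun a t => hom_ext_apply
            (f := (tensorMap γ g f.hom).comp (rMul a))
            (f' := (rMul a).comp (tensorMap γ g f.hom)) (fun _ _ => rfl) t }
      map_smul := fun t s => hom_ext_apply
            (f := (tensorMap γ g f.hom).comp (act γ g N (op s)))
            (f' := (act γ g N' (op s)).comp (tensorMap γ g f.hom)) (fun _ _ => rfl) t }
  map_id N := RightModCat.Hom.ext (LinearMap.ext fun t =>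
    hom_ext_apply (f := tensorMap γ g (LinearMap.id : N →ₗ[(B γ g)ᵐᵒᵖ] N))
      (f' := AddMonoidHom.id _) (fun _ _ => rfl) t)
  map_comp f f' := RightModCat.Hom.ext (LinearMap.ext fun t =>
    hom_ext_apply (f := tensorMap γ g (f'.hom.comp f.hom))
      (f' := (tensorMap γ g f'.hom).comp (tensorMap γ g f.hom)) (fun _ _ => rfl) t)

/-- `Q = C_{g,γ}^C`. -/
abbrev Q : AddSubgroup γ.AsRing := invariants γ g γ.AsRing

theorem mul_mem_Q (c : γ.AsRing) {q : γ.AsRing} (hq : q ∈ Q γ g) : c * q ∈ Q γ g := by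
  intro d
  change (c * q) * d = _
  rw [mul_assoc]
  have h : q * d = q <• γ.pair g.val (γ.toC d) := hq d
  rw [h, ARing.mul_smul_right]

theorem smul_mem_Q (a : A) {q : γ.AsRing} (hq : q ∈ Q γ g) : a • q ∈ Q γ g := by
  intro d
  change (a • q) * d = _
  have h : q * d = q <• γ.pair g.val (γ.toC d) := hq d
  rw [ARing.smul_mul, h, smul_comm]

instance : Module A (Q γ g) where
  smul a q := ⟨a • (q : γ.AsRing), smul_mem_Q γ g a q.2⟩
  one_smul q := Subtype.ext (one_smul A (q : γ.AsRing))
  mul_smul a b q := Subtype.ext (mul_smul a b (q : γ.AsRing))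
  smul_zero a := Subtype.ext (smul_zero a)
  smul_add a q q' := Subtype.ext (smul_add a (q : γ.AsRing) (q' : γ.AsRing))
  add_smul a b q := Subtype.ext (add_smul a b (q : γ.AsRing))
  zero_smul q := Subtype.ext (zero_smul A (q : γ.AsRing))

/-- The left `C`-action on `Q` by multiplication. -/
instance : SMul γ.AsRing (Q γ g) where
  smul c q := ⟨c * (q : γ.AsRing), mul_mem_Q γ g c q.2⟩

end CosepRing

end CoringMorita

open CoringMorita

/-! Everything rests on explicit sections of action maps, checked on pure tensors by the two
versions of `exists_addEquiv`.

For `C` itself the section is `Δ`. Coassociativity and normalization of `γ` give `∑ c₁c₂ = c`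
(`lift_prod_comul`), while `Δ(cd) = ∑ c₁ ⊗ c₂d` becomes `c ⊗ d` once elements of `C` may cross the
tensor sign. So `C` is firm. Over the plain ring one must also know that scalars of `A` may cross,
which is `tmul_balanced`.

Everything else comes from `g`. Since `γ(g ⊗ g) = ε(g) = 1`, it lies in `Q` and fixes every
invariant element: `m · g = m`. Hence `m ↦ m ⊗ g` inverts `M ⊗_C Q → M^C`. Taking `M = C` shows that
`Q` is firm, and taking `M = A` gives `τ`, because the invariants of `A` are `B`.

Moreover `a ↦ ga` embeds the module `A` in `C` as `gA`, since `(ga)c = g(a · c)`, with retraction `c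
↦ 1 · c`, since `1 · (ga) = a`. Thus `a ↦ 1 ⊗ ga` shows that `A` is firm, and `n ⊗ a ↦ (n ⊗ 1) ⊗ ga`
does the same for `N ⊗_B A`. The adjunction is the usual one between tensoring with `A` and
evaluating at `1`: a morphism `f` corresponds to `n ↦ f(n ⊗ 1)`, and conversely `n ⊗ a ↦ h(n)a` is
`C`-linear because `(ma) · c = m(a · c)` for invariant `m`. -/

namespace CoringMorita

open BalTensor

/-! ### Isomorphisms out of tensor products over a ring -/

namespace BalTensor

variable {R M N P : Type*} [AddCommGroup M] [AddCommGroup N] [SMul Rᵐᵒᵖ M] [SMul R N]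
  [AddCommGroup P]

/-- A balanced biadditive map `f` induces an isomorphism `M ⊗_R N ≃ P` if it has a section `s`
with `s (f m n) = m ⊗ n`. -/
theorem exists_addEquiv (f : M → N → P) (hl : ∀ m m' n, f (m + m') n = f m n + f m' n)
    (hr : ∀ m n n', f m (n + n') = f m n + f m n')
    (hb : ∀ m (r : R) n, f (m <• r) n = f m (r • n)) (s : P →+ BalTensor R M N)
    (hs : ∀ m n, s (f m n) = tmul R m n) (hf : ∀ p, lift (R := R) f hl hr hb (s p) = p) :
    ∃ e : BalTensor R M N ≃+ P, ∀ m n, e (tmul R m n) = f m n :=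
  ⟨AddMonoidHom.toAddEquiv (lift (R := R) f hl hr hb) s (hom_ext hs)
    (AddMonoidHom.ext hf), fun _ _ => rfl⟩

end BalTensor

/-! ### Tensor products over an `A`-ring -/

namespace RingTensor

variable {A S M N P : Type*} [Ring A] [AddCommGroup M] [AddCommGroup N] [Module Aᵐᵒᵖ M]
  [Module A N] [SMul Sᵐᵒᵖ M] [SMul S N] [AddCommGroup P]

theorem tmul_add (m : M) (n n' : N) :
    tmul A S m (n + n') = tmul A S m n + tmul A S m n' := by
  unfold tmul
  rw [BalTensor.tmul_add]
  rfl

theorem add_tmul (m m' : M) (n : N) :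
    tmul A S (m + m') n = tmul A S m n + tmul A S m' n := by
  unfold tmul
  rw [BalTensor.add_tmul]
  rfl

theorem smul_tmul (m : M) (s : S) (n : N) :
    tmul A S (m <• s) n = tmul A S m (s • n) :=
  QuotientAddGroup.eq_iff_sub_mem.2 (AddSubgroup.subset_closure ⟨m, s, n, rfl⟩)

/-- The additive map `M ⊗_S N → P` induced by a biadditive map that is balanced over `A` and
over `S`. -/
def lift (f : M → N → P) (hl : ∀ m m' n, f (m + m') n = f m n + f m' n)
    (hr : ∀ m n n', f m (n + n') = f m n + f m n')
    (hA : ∀ m (a : A) n, f (m <• a) n = f m (a • n))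
    (hS : ∀ m (s : S) n, f (m <• s) n = f m (s • n)) : RingTensor A S M N →+ P :=
  QuotientAddGroup.lift _ (BalTensor.lift (R := A) f hl hr hA) (by
    rw [AddSubgroup.closure_le]
    rintro _ ⟨m, s, n, rfl⟩
    simp [hS])

theorem hom_ext {f f' : RingTensor A S M N →+ P}
    (h : ∀ m n, f (tmul A S m n) = f' (tmul A S m n)) : f = f' :=
  QuotientAddGroup.addMonoidHom_ext _ (BalTensor.hom_ext h)

/-- A balanced biadditive map `f` induces an isomorphism `M ⊗_S N ≃ P` if it has a section `s`
with `s (f m n) = m ⊗ n`. -/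
theorem exists_addEquiv (f : M → N → P) (hl : ∀ m m' n, f (m + m') n = f m n + f m' n)
    (hr : ∀ m n n', f m (n + n') = f m n + f m n')
    (hA : ∀ m (a : A) n, f (m <• a) n = f m (a • n))
    (hS : ∀ m (s : S) n, f (m <• s) n = f m (s • n)) (s : P →+ RingTensor A S M N)
    (hs : ∀ m n, s (f m n) = tmul A S m n) (hf : ∀ p, lift f hl hr hA hS (s p) = p) :
    ∃ e : RingTensor A S M N ≃+ P, ∀ m n, e (tmul A S m n) = f m n :=
  ⟨AddMonoidHom.toAddEquiv (lift f hl hr hA hS) s (hom_ext hs)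
    (AddMonoidHom.ext hf), fun _ _ => rfl⟩

end RingTensor

/-! ### Unital modules are firm -/

section Unital

variable (R M : Type*) [Ring R] [AddCommGroup M]

/-- The unit supplies the inverse `m ↦ 1 ⊗ m`. -/
theorem isFirmLeft_of_module [Module R M] : IsFirmLeft R M :=
  BalTensor.exists_addEquiv (fun (r : R) (m : M) => r • m) (fun _ _ _ => add_smul _ _ _)
    (fun _ _ _ => smul_add _ _ _) (fun _ _ _ => mul_smul _ _ _)
    (AddMonoidHom.mk' (BalTensor.tmul R (1 : R)) (fun _ _ => BalTensor.tmul_add _ _ _))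
    (fun r m => by
      change BalTensor.tmul R 1 (r • m) = _
      rw [← BalTensor.smul_tmul, op_smul_eq_mul, one_mul])
    (fun m => one_smul R m)

theorem isFirmRight_of_module [Module Rᵐᵒᵖ M] : IsFirmRight R M :=
  BalTensor.exists_addEquiv (fun (m : M) (r : R) => m <• r) (fun _ _ _ => smul_add _ _ _)
    (fun m r r' => add_smul (op r) (op r') m) (fun m r r' => (mul_smul (op r') (op r) m).symm)
    (AddMonoidHom.mk' (fun m => BalTensor.tmul R m (1 : R)) (fun _ _ => BalTensor.add_tmul _ _ _))
    (fun m r => by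
      change BalTensor.tmul R (m <• r) 1 = _
      rw [BalTensor.smul_tmul, smul_eq_mul, mul_one])
    (fun m => one_smul Rᵐᵒᵖ m)

theorem isNonUnitalModule_of_module [Module R M] : IsNonUnitalModule R M where
  smul_add := smul_add
  add_smul := add_smul
  mul_smul := mul_smul

end Unital

section CosepRing

variable {A : Type u} {C : Type w} [Ring A] [AddCommGroup C] [Module A C] [Module Aᵐᵒᵖ C]
  [SMulCommClass A Aᵐᵒᵖ C] [Coring A C]

/-! ### Firmness of the ring `C` -/

namespace Cointegral

variable (γ : Cointegral A C)

/-- `∑ c₁ c₂ = c`. -/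
theorem lift_prod_comul (c : C) :
    BalTensor.lift (R := A) γ.prod γ.prod_add_left γ.prod_add_right
      (fun x a y => γ.prod_balanced a x y) (Coring.comul (A := A) c) = c := by
  let E : BalTensor A C (BalTensor A C C) →+ C :=
    BalTensor.lift (R := A) (fun x t => x <• γ.toHom t)
      (fun _ _ _ => smul_add _ _ _)
      (fun x s t => by
        rw [show γ.toHom (s + t) = γ.toHom s + γ.toHom t from γ.toHom.map_add' s t,
          MulOpposite.op_add, add_smul])
      (fun x a t => by rw [γ.toHom.map_left, smul_eq_mul, op_mul, mul_smul])
  -- By the definition of the product, `∑ c₁c₂ = ∑ c₁₁ γ(c₁₂ ⊗ c₂)`, which is `E` evaluated on the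
  -- reassociated `(Δ ⊗ C)Δ(c)`.
  have h1 : BalTensor.lift (R := A) γ.prod γ.prod_add_left γ.prod_add_right
      (fun x a y => γ.prod_balanced a x y) (Coring.comul (A := A) c) =
      E (BalTensor.assoc A C C C (rMap Coring.comul.toAddMonoidHom Coring.comul.map_right
        (Coring.comul (A := A) c))) := by
    refine hom_ext_apply (f' := (E.comp (BalTensor.assoc A C C C)).comp (rMap _ _))
      (fun x y => ?_) _
    exact hom_ext_apply (f := contractRight γ.toHom y)
      (f' := (E.comp (BalTensor.assoc A C C C)).comp
        (AddMonoidHom.mk' (fun t => BalTensor.tmul A t y) (fun s t => BalTensor.add_tmul s t y)))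
      (fun _ _ => rfl) _
  -- Coassociativity turns the sum into `∑ c₁ γ(c₂₁ ⊗ c₂₂)`. Normalization makes this `∑ c₁ ε(c₂)`,
  -- and the counit axiom finishes.
  rw [h1, ← Coring.coassoc]
  refine Eq.trans ?_ (Coring.counit_right (A := A) c)
  refine hom_ext_apply
    (f := E.comp (lMap Coring.comul.toAddMonoidHom Coring.comul.map_left)) (fun x y => ?_) _
  exact congrArg (fun a : A => x <• a) (γ.normalized y)

/-- The comultiplication of `C` on the `A`-ring `C`. -/
def comulRing : γ.AsRing →+ BalTensor A γ.AsRing γ.AsRing :=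
  (Coring.comul (A := A) (C := C)).toAddMonoidHom

/-- The product of the `A`-ring `C` as a map `C ⊗_A C → C`. -/
def mulRing : BalTensor A γ.AsRing γ.AsRing →+ γ.AsRing :=
  BalTensor.lift (fun c d => c * d) add_mul mul_add (fun c a d => ARing.balanced a c d)

theorem mulRing_comulRing (c : γ.AsRing) : γ.mulRing (γ.comulRing c) = c :=
  γ.lift_prod_comul c

theorem comulRing_mul (c d : γ.AsRing) : γ.comulRing (c * d) =
    lMap (AddMonoidHom.mulRight d) (fun a z => ARing.smul_mul a z d) (γ.comulRing c) :=
  γ.comul_prod c d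

/-- The plain tensor product over `C` imposes no relation for `A`. It holds anyway because every
element of `C` is a sum of products: `(uv)a ⊗ y = u(va) ⊗ y = u ⊗ (va)y = u ⊗ v(ay) = uv ⊗ ay`. -/
theorem tmul_balanced (x y : γ.AsRing) (a : A) :
    BalTensor.tmul γ.AsRing (x <• a) y = BalTensor.tmul γ.AsRing x (a • y) := by
  -- Writing `x = ∑ x₁x₂` reduces the claim, additive in `x`, to products `x = uv`.
  rw [← γ.mulRing_comulRing x]
  refine hom_ext_apply
    (f := (AddMonoidHom.mk' (fun z : γ.AsRing => BalTensor.tmul γ.AsRing (z <• a) y)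
      (fun z z' => by rw [smul_add, BalTensor.add_tmul])).comp γ.mulRing)
    (f' := (AddMonoidHom.mk' (fun z : γ.AsRing => BalTensor.tmul γ.AsRing z (a • y))
      (fun z z' => BalTensor.add_tmul _ _ _)).comp γ.mulRing)
    (fun u v => ?_) _
  change BalTensor.tmul γ.AsRing ((u * v) <• a) y = BalTensor.tmul γ.AsRing (u * v) (a • y)
  rw [← ARing.mul_smul_right, ← op_smul_eq_mul, BalTensor.smul_tmul, smul_eq_mul,
    ARing.balanced, ← smul_eq_mul v, ← BalTensor.smul_tmul, op_smul_eq_mul]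

/-- The canonical map `C ⊗_A C → C ⊗_C C`. -/
def toSelfTensor : BalTensor A γ.AsRing γ.AsRing →+ BalTensor γ.AsRing γ.AsRing γ.AsRing :=
  BalTensor.lift (BalTensor.tmul γ.AsRing) BalTensor.add_tmul BalTensor.tmul_add
    (fun x a y => γ.tmul_balanced x y a)

/-- `Δ` is right `C`-linear, so the left side is `∑ c₁ ⊗ c₂d = ∑ c₁c₂ ⊗ d = c ⊗ d`. -/
theorem toSelfTensor_comulRing_mul (c d : γ.AsRing) :
    γ.toSelfTensor (γ.comulRing (c * d)) = BalTensor.tmul γ.AsRing c d := by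
  rw [γ.comulRing_mul]
  refine (hom_ext_apply
    (f := γ.toSelfTensor.comp (lMap (AddMonoidHom.mulRight d)
      (fun a z => ARing.smul_mul a z d)))
    (f' := (AddMonoidHom.mk' (fun z : γ.AsRing => BalTensor.tmul γ.AsRing z d)
      (fun _ _ => BalTensor.add_tmul _ _ _)).comp γ.mulRing)
    (fun x y => (BalTensor.smul_tmul x y d).symm) _).trans ?_
  exact congrArg (fun z => BalTensor.tmul γ.AsRing z d) (γ.mulRing_comulRing c)

/-- The inverse is `c ↦ ∑ c₁ ⊗ c₂`, read in `C ⊗_C C`. The same isomorphism expresses left and right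
firmness. -/
theorem exists_selfTensor_addEquiv :
    ∃ e : BalTensor γ.AsRing γ.AsRing γ.AsRing ≃+ γ.AsRing,
      ∀ c d : γ.AsRing, e (BalTensor.tmul γ.AsRing c d) = c * d :=
  BalTensor.exists_addEquiv (fun c d : γ.AsRing => c * d) add_mul mul_add mul_assoc
    (γ.toSelfTensor.comp γ.comulRing) γ.toSelfTensor_comulRing_mul
    (fun c => (hom_ext_apply
      (f := (BalTensor.lift (R := γ.AsRing) (fun c d : γ.AsRing => c * d) add_mul mul_add
        mul_assoc).comp γ.toSelfTensor)
      (f' := γ.mulRing) (fun _ _ => rfl) _).trans (γ.mulRing_comulRing c))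

end Cointegral

/-! ### The grouplike element and invariants -/

variable (γ : Cointegral A C) (g : Grouplike A C)

/-- Normalization at `g` reads `γ(g ⊗ g) = ε(g)`. This is what makes `g` act as a unit on
invariants. -/
theorem Grouplike.pair_self : γ.pair g.val g.val = 1 := by
  have h := γ.normalized g.val
  rwa [g.comul_eq, g.counit_eq] at h

/-- A grouplike element as an element of the `A`-ring `C`. -/
def Grouplike.toRing : γ.AsRing := g.val

theorem Grouplike.toRing_mul (c : γ.AsRing) :
    g.toRing γ * c = g.toRing γ <• γ.pair g.val (γ.toC c) := by
  have h := GModule.prod_eq γ g 1 (γ.toC c)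
  rwa [op_one, one_smul] at h

theorem Grouplike.toRing_mem_Q : g.toRing γ ∈ Q γ g := g.toRing_mul γ

/-- A grouplike element as an element of `Q`. -/
def Grouplike.toQ : Q γ g := ⟨g.toRing γ, g.toRing_mem_Q γ⟩

/-- `(g a) c = g γ(g a ⊗ c)`, with `γ(g a ⊗ c) = a · c`. -/
theorem Grouplike.toRing_smul_mul (a : A) (c : γ.AsRing) :
    (g.toRing γ <• a) * c = g.toRing γ <• γ.pair (g.val <• a) (γ.toC c) :=
  GModule.prod_eq γ g a (γ.toC c)

/-- `1 · (g a) = a`. -/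
theorem GModule.one_smul_toRing (a : A) :
    GModule.of γ g 1 <• (g.toRing γ <• a) = GModule.of γ g a := by
  change γ.pair (g.val <• (1 : A)) (g.val <• a) = a
  rw [op_one, one_smul, γ.pair_smul_right, g.pair_self, one_mul]

theorem smul_toRing_of_mem_invariants {M : Type*} [AddCommGroup M] [Module Aᵐᵒᵖ M]
    [SMul (γ.AsRing)ᵐᵒᵖ M] [IsRightModule A γ.AsRing M] {m : M} (hm : m ∈ invariants γ g M) :
    m <• g.toRing γ = m := by
  rw [hm]
  change m <• γ.pair g.val g.val = m
  rw [g.pair_self, op_one, one_smul]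

/-- `(m a) · c = m (a · c)` for an invariant element `m`. -/
theorem smul_smul_of_mem_invariants {M : Type*} [AddCommGroup M] [Module Aᵐᵒᵖ M]
    [SMul (γ.AsRing)ᵐᵒᵖ M] [IsRightModule A γ.AsRing M] {m : M} (hm : m ∈ invariants γ g M)
    (a : A) (c : γ.AsRing) : (m <• a) <• c = m <• γ.pair (g.val <• a) (γ.toC c) := by
  rw [IsRightModule.balanced, hm, γ.pair_balanced]
  rfl

/-- Invariance passes from `q` to `m · q`: `(m · q) · c = m · (qc) = m · (q γ(g ⊗ c)) = (m · q) γ(g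
⊗ c)`. -/
theorem smul_mem_invariants {M : Type*} [AddCommGroup M] [Module Aᵐᵒᵖ M]
    [SMul (γ.AsRing)ᵐᵒᵖ M] [IsRightModule A γ.AsRing M] (m : M) (q : Q γ g) :
    m <• (q : γ.AsRing) ∈ invariants γ g M := by
  intro c
  have h : (q : γ.AsRing) * c = (q : γ.AsRing) <• γ.pair g.val (γ.toC c) := q.2 c
  rw [← IsNonUnitalModule.mul_smul, ← op_mul, h, IsRightModule.linear]

/-! ### Tensoring with `Q` computes invariants -/

/-- The action of `Q` on `M` as a map `M × Q → M_{g,γ}^C`. -/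
def smulQ {M : Type*} [AddCommGroup M] [Module Aᵐᵒᵖ M] [SMul (γ.AsRing)ᵐᵒᵖ M]
    [IsRightModule A γ.AsRing M] (m : M) (q : Q γ g) : invariants γ g M :=
  ⟨m <• (q : γ.AsRing), smul_mem_invariants γ g m q⟩

section SmulQ

variable {M : Type*} [AddCommGroup M] [Module Aᵐᵒᵖ M] [SMul (γ.AsRing)ᵐᵒᵖ M]
    [IsRightModule A γ.AsRing M]

theorem add_smulQ (m m' : M) (q : Q γ g) :
    smulQ γ g (m + m') q = smulQ γ g m q + smulQ γ g m' q :=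
  Subtype.ext (IsNonUnitalModule.smul_add (op (q : γ.AsRing)) m m')

theorem smulQ_add (m : M) (q q' : Q γ g) :
    smulQ γ g m (q + q') = smulQ γ g m q + smulQ γ g m q' :=
  Subtype.ext (IsNonUnitalModule.add_smul (op (q : γ.AsRing)) (op (q' : γ.AsRing)) m)

theorem smul_smulQ (m : M) (c : γ.AsRing) (q : Q γ g) :
    smulQ γ g (m <• c) q = smulQ γ g m (c • q) :=
  Subtype.ext (IsNonUnitalModule.mul_smul (op (q : γ.AsRing)) (op c) m).symm

theorem smul_smulQ_left (m : M) (a : A) (q : Q γ g) :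
    smulQ γ g (m <• a) q = smulQ γ g m (a • q) :=
  Subtype.ext (IsRightModule.balanced m a (q : γ.AsRing))

theorem smulQ_toQ (m : invariants γ g M) : smulQ γ g (m : M) (g.toQ γ) = m :=
  Subtype.ext (smul_toRing_of_mem_invariants γ g m.2)

end SmulQ

/-- `q g = q` for `q ∈ Q`. -/
theorem smul_toQ (q : Q γ g) : (q : γ.AsRing) • g.toQ γ = q := smulQ_toQ γ g q

/-- The inverse is `m ↦ m ⊗ g`: on one side `m · q ⊗ g = m ⊗ qg = m ⊗ q`, on the other `m · g = m`
for invariant `m`. This version, over the plain ring, feeds the Morita context. -/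
theorem exists_balTensor_Q_addEquiv (M : Type*) [AddCommGroup M] [Module Aᵐᵒᵖ M]
    [SMul (γ.AsRing)ᵐᵒᵖ M] [IsRightModule A γ.AsRing M] :
    ∃ e : BalTensor γ.AsRing M (Q γ g) ≃+ invariants γ g M,
      ∀ m q, e (BalTensor.tmul γ.AsRing m q) = smulQ γ g m q :=
  BalTensor.exists_addEquiv (smulQ γ g) (add_smulQ γ g) (smulQ_add γ g) (smul_smulQ γ g)
    (AddMonoidHom.mk' (fun m => BalTensor.tmul γ.AsRing (m : M) (g.toQ γ))
      (fun _ _ => BalTensor.add_tmul _ _ _))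
    (fun m q => (BalTensor.smul_tmul m (q : γ.AsRing) (g.toQ γ)).trans
      (congrArg (BalTensor.tmul γ.AsRing m) (smul_toQ γ g q)))
    (smulQ_toQ γ g)

/-- The same inverse `m ↦ m ⊗ g` works for the tensor product over the `A`-ring; this is the map
`ω_M`. -/
theorem exists_ringTensor_Q_addEquiv (M : Type*) [AddCommGroup M] [Module Aᵐᵒᵖ M]
    [SMul (γ.AsRing)ᵐᵒᵖ M] [IsRightModule A γ.AsRing M] :
    ∃ e : RingTensor A γ.AsRing M (Q γ g) ≃+ invariants γ g M,
      ∀ m q, e (RingTensor.tmul A γ.AsRing m q) = smulQ γ g m q :=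
  RingTensor.exists_addEquiv (smulQ γ g) (add_smulQ γ g) (smulQ_add γ g) (smul_smulQ_left γ g)
    (smul_smulQ γ g)
    (AddMonoidHom.mk' (fun m => RingTensor.tmul A γ.AsRing (m : M) (g.toQ γ))
      (fun _ _ => RingTensor.add_tmul _ _ _))
    (fun m q => (RingTensor.smul_tmul m (q : γ.AsRing) (g.toQ γ)).trans
      (congrArg (RingTensor.tmul A γ.AsRing m) (smul_toQ γ g q)))
    (smulQ_toQ γ g)

instance : IsLeftModule A γ.AsRing (Q γ g) where
  smul_add c q q' := Subtype.ext (mul_add c (q : γ.AsRing) (q' : γ.AsRing))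
  add_smul c d q := Subtype.ext (add_mul c d (q : γ.AsRing))
  mul_smul c d q := Subtype.ext (mul_assoc c d (q : γ.AsRing))
  balanced q a c := Subtype.ext (ARing.balanced a c (q : γ.AsRing)).symm
  linear q a c := Subtype.ext (ARing.smul_mul a c (q : γ.AsRing)).symm

/-- `Q` is by definition the invariants of `C`, so this is `ω_C`. -/
theorem isFirmLeftModule_Q : IsFirmLeftModule A γ.AsRing (Q γ g) :=
  exists_ringTensor_Q_addEquiv γ g γ.AsRing

theorem isFirmLeft_Q : IsFirmLeft γ.AsRing (Q γ g) :=
  exists_balTensor_Q_addEquiv γ g γ.AsRing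

/-! ### Firmness of `A` and of `N ⊗_B A` -/

theorem isFirmRight_GModule : IsFirmRight γ.AsRing (GModule γ g) :=
  BalTensor.exists_addEquiv (fun (a : GModule γ g) (c : γ.AsRing) => a <• c)
    (fun a b c => IsNonUnitalModule.smul_add (op c) a b)
    (fun a c d => IsNonUnitalModule.add_smul (op c) (op d) a)
    (fun a c d => (IsNonUnitalModule.mul_smul (op d) (op c) a).symm)
    (AddMonoidHom.mk'
      (fun a : GModule γ g =>
        BalTensor.tmul γ.AsRing (GModule.of γ g 1) (g.toRing γ <• (show A from a)))
      (fun a b => by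
        rw [← BalTensor.tmul_add]
        exact congrArg _ (add_smul (op (show A from a)) (op (show A from b)) (g.toRing γ))))
    -- `1 ⊗ g(a · c) = 1 ⊗ (ga)c = 1 · (ga) ⊗ c = a ⊗ c`.
    (fun a c => by
      change BalTensor.tmul γ.AsRing (GModule.of γ g 1)
        (g.toRing γ <• γ.pair (g.val <• (show A from a)) (γ.toC c)) = _
      rw [← g.toRing_smul_mul, ← smul_eq_mul, ← BalTensor.smul_tmul, GModule.one_smul_toRing]
      rfl)
    (fun a => GModule.one_smul_toRing γ g a)

/-- `n ⊗ a ↦ (n ⊗ 1) ⊗ g a`, the inverse of the action map of `N ⊗_B A`. -/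
def tensorSection (N : Type*) [AddCommGroup N] [Module (B γ g)ᵐᵒᵖ N] :
    BalTensor (B γ g) N (GModule γ g) →+
      RingTensor A γ.AsRing (BalTensor (B γ g) N (GModule γ g)) γ.AsRing :=
  BalTensor.lift
    (fun n a => RingTensor.tmul A γ.AsRing (BalTensor.tmul (B γ g) n (GModule.of γ g 1))
      (g.toRing γ <• (show A from a)))
    (fun n n' a => by rw [BalTensor.add_tmul, RingTensor.add_tmul])
    (fun n a b => by
      rw [← RingTensor.tmul_add]
      exact congrArg _ (add_smul (op (show A from a)) (op (show A from b)) (g.toRing γ)))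
    (fun n b a => by
      -- Membership of `b` in `B` is used here: `γ(gb ⊗ ga) = b γ(g ⊗ g) a = ba`, so `(gb)(ga) =
      -- g(ba)`.
      have h : g.toRing γ <• ((b : A) * (show A from a)) =
          (g.toRing γ <• (b : A)) * (g.toRing γ <• (show A from a)) := by
        rw [g.toRing_smul_mul]
        congr 2
        change _ = γ.pair (g.val <• (b : A)) (g.val <• (show A from a))
        rw [b.2, γ.pair_smul_right, g.pair_self, one_mul]
      -- Since `1 · (gb) = b`, the scalar `b` can be produced by acting with `gb ∈ C`. It then
      -- crosses the outer tensor sign and is absorbed by `h`.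
      have h' : BalTensor.tmul (B γ g) (n <• b) (GModule.of γ g 1) =
          BalTensor.tmul (B γ g) n (GModule.of γ g 1) <• (g.toRing γ <• (b : A)) := by
        rw [BalTensor.smul_tmul]
        refine congrArg (BalTensor.tmul (B γ g) n)
          (Eq.trans ?_ (GModule.one_smul_toRing γ g (b : A)).symm)
        exact mul_one (b : A)
      rw [h', RingTensor.smul_tmul]
      exact congrArg _ h.symm)

theorem isFirm_tensorFunctor_obj (N : ModuleCat.{max u v} (B γ g)ᵐᵒᵖ) :
    RightModCat.IsFirm ((tensorFunctor.{u, v, w} γ g).obj N) := by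
  let T := BalTensor (B γ g) N (GModule γ g)
  have hl (m m' : T) (c : γ.AsRing) : (m + m') <• c = m <• c + m' <• c :=
    IsNonUnitalModule.smul_add (op c) m m'
  have hr (m : T) (c d : γ.AsRing) : m <• (c + d) = m <• c + m <• d :=
    IsNonUnitalModule.add_smul (op c) (op d) m
  have hA (m : T) (a : A) (c : γ.AsRing) : (m <• a) <• c = m <• (a • c) :=
    IsRightModule.balanced m a c
  have hS (m : T) (c d : γ.AsRing) : (m <• c) <• d = m <• (c • d) :=
    (IsNonUnitalModule.mul_smul (op d) (op c) m).symm
  refine RingTensor.exists_addEquiv (fun (m : T) (c : γ.AsRing) => m <• c) hl hr hA hS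
    (tensorSection γ g N) (fun m c => ?_) (fun m => ?_)
  -- `(n ⊗ 1) ⊗ g(a · c) = (n ⊗ 1) ⊗ (ga)c = (n ⊗ 1) · (ga) ⊗ c = (n ⊗ a) ⊗ c`.
  · refine hom_ext_apply (f := (tensorSection γ g N).comp (act γ g N (op c)))
      (f' := AddMonoidHom.mk' (fun m : T => RingTensor.tmul A γ.AsRing m c)
        (fun _ _ => RingTensor.add_tmul _ _ _)) (fun n a => ?_) m
    change RingTensor.tmul A γ.AsRing (BalTensor.tmul (B γ g) n (GModule.of γ g 1))
      (g.toRing γ <• γ.pair (g.val <• (show A from a)) (γ.toC c)) = _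
    rw [← g.toRing_smul_mul, ← smul_eq_mul, ← RingTensor.smul_tmul]
    exact congrArg (fun x => RingTensor.tmul A γ.AsRing (BalTensor.tmul (B γ g) n x) c)
      (GModule.one_smul_toRing γ g a)
  · exact hom_ext_apply
      (f := (RingTensor.lift (fun (m : T) (c : γ.AsRing) => m <• c) hl hr hA hS).comp
        (tensorSection γ g N))
      (f' := AddMonoidHom.id T)
      (fun n a => congrArg (BalTensor.tmul (B γ g) n) (GModule.one_smul_toRing γ g a)) m

/-! ### The adjunction between `- ⊗_B A` and invariants -/

section Adjunction

variable {γ g} {N : Type*} [AddCommGroup N] [Module (B γ g)ᵐᵒᵖ N]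
  {M : Type*} [AddCommGroup M] [Module Aᵐᵒᵖ M] [SMul (γ.AsRing)ᵐᵒᵖ M]
  [IsRightModule A γ.AsRing M]

/-- The map `N ⊗_B A → M`, `n ⊗ a ↦ h(n) a`, induced by a `B`-linear map `h : N → M_{g,γ}^C`. -/
def tensorLift (h : N →ₗ[(B γ g)ᵐᵒᵖ] invariants γ g M) :
    BalTensor (B γ g) N (GModule γ g) →+ M :=
  BalTensor.lift (fun n a => (h n : M) <• (show A from a))
    (fun n n' a => by rw [map_add]; exact smul_add _ _ _)
    (fun n a b => add_smul (op (show A from a)) (op (show A from b)) (h n : M))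
    (fun n b a => by
      rw [map_smul]
      exact (mul_smul (op (show A from a)) (op (b : A)) (h n : M)).symm)

theorem tensorLift_op_smul (h : N →ₗ[(B γ g)ᵐᵒᵖ] invariants γ g M) (a : Aᵐᵒᵖ)
    (t : BalTensor (B γ g) N (GModule γ g)) : tensorLift h (a • t) = a • tensorLift h t :=
  hom_ext_apply (f := (tensorLift h).comp (rMul a))
    (f' := (DistribSMul.toAddMonoidHom M a).comp (tensorLift h))
    (fun n x => mul_smul a (op (show A from x)) (h n : M)) t

theorem tensorLift_smul (h : N →ₗ[(B γ g)ᵐᵒᵖ] invariants γ g M)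
    (t : BalTensor (B γ g) N (GModule γ g)) (c : γ.AsRing) :
    tensorLift h (t <• c) = tensorLift h t <• c :=
  hom_ext_apply (f := (tensorLift h).comp (act γ g N (op c)))
    (f' := (AddMonoidHom.mk' (fun m : M => m <• c)
      (fun m m' => IsNonUnitalModule.smul_add (op c) m m')).comp (tensorLift h))
    (fun n x => (smul_smul_of_mem_invariants γ g (h n).2 (show A from x) c).symm) t

/-- The `B`-linear map `N → M_{g,γ}^C`, `n ↦ f(n ⊗ 1)`, given by a morphism `f : N ⊗_B A → M`. -/
def restrictInvariants (f : BalTensor (B γ g) N (GModule γ g) →ₗ[Aᵐᵒᵖ] M)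
    (hf : ∀ t (c : γ.AsRing), f (t <• c) = f t <• c) :
    N →ₗ[(B γ g)ᵐᵒᵖ] invariants γ g M where
  toFun n := ⟨f (BalTensor.tmul (B γ g) n (GModule.of γ g 1)), fun c => by
    -- `n ⊗ 1` is already invariant in `N ⊗_B A`, because `1 · c = γ(g ⊗ c)` in `A`; morphisms
    -- preserve invariance.
    rw [← hf, ← map_smul]
    refine congrArg (fun x => f (BalTensor.tmul (B γ g) n x)) ?_
    change γ.pair (g.val <• (1 : A)) (γ.toC c) = 1 * γ.pair g.val (γ.toC c)
    rw [op_one, one_smul, one_mul]⟩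
  map_add' n n' := Subtype.ext ((congrArg f (BalTensor.add_tmul n n' _)).trans (f.map_add _ _))
  map_smul' b n := Subtype.ext (by
    -- `nb ⊗ 1 = n ⊗ b = (n ⊗ 1)b`, where the last `b` acts through `A`.
    refine Eq.trans ?_ (f.map_smul (op ((unop b : B γ g) : A)) _)
    refine congrArg f ((BalTensor.smul_tmul n (unop b) _).trans ?_)
    refine congrArg (BalTensor.tmul (B γ g) n) ?_
    exact (mul_one ((unop b : B γ g) : A)).trans (one_mul _).symm)

/-- `n ⊗ a = (n ⊗ 1)a`, so an `A`-linear map is determined by its values on the `n ⊗ 1`. -/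
theorem tensorLift_restrictInvariants (f : BalTensor (B γ g) N (GModule γ g) →ₗ[Aᵐᵒᵖ] M)
    (hf : ∀ t (c : γ.AsRing), f (t <• c) = f t <• c)
    (t : BalTensor (B γ g) N (GModule γ g)) :
    tensorLift (restrictInvariants f hf) t = f t :=
  hom_ext_apply (f' := f.toAddMonoidHom) (fun n a =>
    (f.map_smul (op (show A from a))
      (BalTensor.tmul (B γ g) n (GModule.of γ g 1))).symm.trans
      (congrArg (fun x => f (BalTensor.tmul (B γ g) n x)) (one_mul (show A from a)))) t

end Adjunction

/-- The bijection `Hom_C(N ⊗_B A, M) ≃ Hom_B(N, M_{g,γ}^C)`. -/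
def tensorHomEquiv (N : ModuleCat.{max u v} (B γ g)ᵐᵒᵖ)
    (M : RightModCat.{u, max u v, w} A γ.AsRing) :
    ((tensorFunctor.{u, v, w} γ g).obj N ⟶ M) ≃
      (N ⟶ (invFunctor.{u, max u v, w} γ g).obj M) where
  toFun f := ModuleCat.ofHom (restrictInvariants (RightModCat.Hom.toLinearMap f)
    (RightModCat.Hom.map_smul f))
  invFun h :=
    { toLinearMap :=
        { toFun := tensorLift (γ := γ) (g := g) (M := M) h.hom
          map_add' := map_add _
          map_smul' := tensorLift_op_smul h.hom }
      map_smul := tensorLift_smul h.hom }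
  left_inv f := RightModCat.Hom.ext (LinearMap.ext fun t =>
    tensorLift_restrictInvariants (RightModCat.Hom.toLinearMap f) (RightModCat.Hom.map_smul f) t)
  right_inv h := ModuleCat.hom_ext (LinearMap.ext fun n => Subtype.ext
    (one_smul Aᵐᵒᵖ (((show N →ₗ[(B γ g)ᵐᵒᵖ] invariants γ g M from h.hom) n :
      invariants γ g M) : M)))

/-- The functor `- ⊗_B A` is left adjoint to the functor of invariants on firm modules. -/
def tensorAdjunction :
    ObjectProperty.lift RightModCat.IsFirm (tensorFunctor.{u, v, w} γ g)
        (isFirm_tensorFunctor_obj γ g) ⊣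
      (RightModCat.IsFirm (A := A) (S := γ.AsRing)).ι ⋙ invFunctor.{u, max u v, w} γ g :=
  Adjunction.mkOfHomEquiv
    { homEquiv := fun N M =>
        -- Firm modules form a full subcategory, so the bijection for all right `C`-modules
        -- restricts.
        (RightModCat.IsFirm.fullyFaithfulι.homEquiv).trans (tensorHomEquiv γ g N M.obj)
      homEquiv_naturality_left_symm := fun {N N' M} f h => by
        apply RightModCat.IsFirm.ι.map_injective
        exact RightModCat.Hom.ext (LinearMap.ext fun t => hom_ext_apply
          (f := tensorLift (γ := γ) (g := g) (M := M.obj) (f ≫ h).hom)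
          (f' := (tensorLift (γ := γ) (g := g) (M := M.obj) h.hom).comp (tensorMap γ g f.hom))
          (fun n a => rfl) t)
      homEquiv_naturality_right := fun f h => by
        refine ModuleCat.hom_ext (LinearMap.ext fun n => Subtype.ext ?_)
        rfl }

/-! ### The Morita context -/

/-- The Morita context between `B` and `C` given by `A` and `Q`. -/
theorem exists_moritaContext :
    ∃ ctx : MoritaContext (B γ g) γ.AsRing (GModule γ g) (Q γ g),
      (∀ (q : Q γ g) (a : A), ctx.σ (BalTensor.tmul (B γ g) q (GModule.of γ g a)) =
        (q : γ.AsRing) <• a) ∧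
      (∀ (a : A) (q : Q γ g), (ctx.τ (BalTensor.tmul γ.AsRing (GModule.of γ g a) q) : A) =
        γ.pair (g.val <• a) (γ.toC q)) ∧ Function.Bijective ctx.τ := by
  -- `τ` is the isomorphism `A ⊗_C Q ≃ A^C` followed by the identification `i` of `A^C` with `B`, so
  -- its bijectivity is built in.
  obtain ⟨e, he⟩ := exists_balTensor_Q_addEquiv γ g (GModule γ g)
  let i : invariants γ g (GModule γ g) ≃+ B γ g :=
    { toFun := fun a => ⟨(a : GModule γ g), a.2⟩
      invFun := fun b => ⟨(b : A), b.2⟩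
      left_inv := fun _ => rfl
      right_inv := fun _ => rfl
      map_add' := fun _ _ => rfl }
  have hτ (a : GModule γ g) (q : Q γ g) : (i (e (BalTensor.tmul γ.AsRing a q)) : A) =
      γ.pair (g.val <• (show A from a)) (γ.toC q) :=
    congrArg (fun x => (i x : A)) (he a q)
  let σ : BalTensor (B γ g) (Q γ g) (GModule γ g) →+ γ.AsRing :=
    BalTensor.lift (fun q a => (q : γ.AsRing) <• (show A from a))
      (fun _ _ _ => smul_add _ _ _)
      (fun q a b => add_smul (op (show A from a)) (op (show A from b)) (q : γ.AsRing))
      (fun q b a => (mul_smul (op (show A from a)) (op (b : A)) (q : γ.AsRing)).symm)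
  -- The single identity `(qa)c = q(a · c)` gives right linearity of `σ` and, for `c = q' ∈ Q`, the
  -- relation `σ(q ⊗ a)q' = q τ(a ⊗ q')`.
  have hσ (q : Q γ g) (a : A) (c : γ.AsRing) : ((q : γ.AsRing) <• a) * c =
      (q : γ.AsRing) <• γ.pair (g.val <• a) (γ.toC c) :=
    smul_smul_of_mem_invariants γ g q.2 a c
  refine ⟨{
    firm_R_left := isFirmLeft_of_module _ _
    firm_R_right := isFirmRight_of_module _ _
    firm_S_left := γ.exists_selfTensor_addEquiv
    firm_S_right := γ.exists_selfTensor_addEquiv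
    V_left := isNonUnitalModule_of_module _ _
    V_right := inferInstance
    V_comm := inferInstance
    V_firm_left := isFirmLeft_of_module _ _
    V_firm_right := isFirmRight_GModule γ g
    W_left := inferInstance
    W_right := isNonUnitalModule_of_module _ _
    W_comm := ⟨fun c b q => Subtype.ext
      (ARing.mul_smul_right ((unop b : B γ g) : A) c (q : γ.AsRing))⟩
    W_firm_left := isFirmLeft_Q γ g
    W_firm_right := isFirmRight_of_module _ _
    σ := σ
    σ_left := fun c q a => (ARing.mul_smul_right (show A from a) c (q : γ.AsRing)).symm
    σ_right := fun c q a => (hσ q a c).symm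
    τ := i.toAddMonoidHom.comp e.toAddMonoidHom
    τ_left := fun b a q => Subtype.ext ?_
    τ_right := fun b a q => Subtype.ext ?_
    σ_smul := fun q a q' => Subtype.ext ?_
    τ_smul := fun a q a' => ?_ }, fun q a => rfl, hτ, i.bijective.comp e.bijective⟩
  · refine (hτ (b • a) q).trans (Eq.trans ?_ (congrArg (fun x => (b : A) * x) (hτ a q)).symm)
    change γ.pair (g.val <• ((b : A) * (show A from a))) _ = _
    -- `γ(gba ⊗ q) = γ(gb ⊗ aq) = b γ(g ⊗ aq) = b γ(ga ⊗ q)`: `a` is moved aside so that the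
    -- condition defining `B` applies.
    rw [op_mul, mul_smul, γ.pair_balanced, b.2, γ.pair_balanced]
  · refine (hτ a (q <• b)).trans (Eq.trans ?_ (congrArg (fun x => x * (b : A)) (hτ a q)).symm)
    exact γ.pair_smul_right (b : A) _ _
  · exact (hσ q a q').trans (congrArg (fun x => (q : γ.AsRing) <• x) (hτ a q')).symm
  · refine (congrArg (fun x => x * (show A from a')) (hτ a q)).trans ?_
    exact (γ.pair_smul_right (show A from a') _ _).symm

end CosepRing

end CoringMorita

theorem mainTheorem2 {A : Type u} {C : Type w} [Ring A] [AddCommGroup C] [Module A C]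
    [Module Aᵐᵒᵖ C] [SMulCommClass A Aᵐᵒᵖ C] [Coring A C]
    (γ : Cointegral A C) (g : Grouplike A C) :
    -- (1)
    ((B γ g : Set A) = {b : A | ∀ c : C, γ.pair (g.val <• b) c = b * γ.pair g.val c} ∧
      ∀ b : A, b ∈ B γ g ↔ GModule.of γ g b ∈ invariants γ g (GModule γ g)) ∧
    -- (2)
    (∃ h : ∀ N : ModuleCat.{max u v} (B γ g)ᵐᵒᵖ,
        RightModCat.IsFirm ((tensorFunctor.{u, v, w} γ g).obj N),
      Nonempty (ObjectProperty.lift RightModCat.IsFirm (tensorFunctor.{u, v, w} γ g) h ⊣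
        (RightModCat.IsFirm (A := A) (S := γ.AsRing)).ι ⋙
          invFunctor.{u, max u v, w} γ g)) ∧
    -- (3)
    ((∀ c q : γ.AsRing, q ∈ Q γ g → c * q ∈ Q γ g) ∧
      IsLeftModule A γ.AsRing (Q γ g) ∧ IsFirmLeftModule A γ.AsRing (Q γ g) ∧
      ∀ (c : γ.AsRing) (q : Q γ g) (b : B γ g), (c • q) <• b = c • (q <• b)) ∧
    -- (4)
    (∀ M : RightModCat.{u, v, w} A γ.AsRing, M.IsFirm →
      ∃ ω : RingTensor A γ.AsRing M (Q γ g) ≃+ invariants γ g M,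
        ∀ (m : M) (q : Q γ g),
          (ω (RingTensor.tmul A γ.AsRing m q) : M) = m <• (q : γ.AsRing)) ∧
    -- (5)
    (∃ ctx : MoritaContext (B γ g) γ.AsRing (GModule γ g) (Q γ g),
      (∀ (q : Q γ g) (a : A), ctx.σ (BalTensor.tmul (B γ g) q (GModule.of γ g a)) =
        (q : γ.AsRing) <• a) ∧
      (∀ (a : A) (q : Q γ g), (ctx.τ (BalTensor.tmul γ.AsRing (GModule.of γ g a) q) : A) =
        γ.pair (g.val <• a) (γ.toC q)) ∧
      Function.Surjective ctx.τ ∧ Function.Bijective ctx.τ) := by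
  -- Part (1) holds by unfolding: with `a · c = γ(ga ⊗ c)`, invariance in `A` is literally the
  -- condition defining `B`.
  refine ⟨⟨rfl, fun _ => Iff.rfl⟩, ⟨isFirm_tensorFunctor_obj γ g, ⟨tensorAdjunction γ g⟩⟩,
    ⟨fun c q hq => mul_mem_Q γ g c hq, inferInstance, isFirmLeftModule_Q γ g, fun c q b =>
      Subtype.ext (ARing.mul_smul_right (b : A) c (q : γ.AsRing)).symm⟩, fun M _ => ?_, ?_⟩
  · obtain ⟨e, he⟩ := exists_ringTensor_Q_addEquiv γ g M
    exact ⟨e, fun m q => congrArg Subtype.val (he m q)⟩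
  · obtain ⟨ctx, hσ, hτ, h⟩ := exists_moritaContext γ g
    exact ⟨ctx, hσ, hτ, h.surjective, h⟩
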